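/- Theorem 2.1 (Optimality of the droplet spectrum). Let $\Delta>1$, $\lambda>0$ and $\beta\ge\frac12\left(1-\frac1\Delta\right)$, and let $\omega=(\omega_i)_{i\in\mathbb Z}$ be independent identically distributed real random variables whose common distribution $\mu$ satisfies $\{0,1\}\subset\operatorname{supp}\mu\subset[0,1]$ and $\mu(\{0\})=0$. For $L\in\mathbb N=\{1,2,\dots\}$ let $$H^{(L)}=H^{(L)}_\omega=\sum_{i=-L}^{L-1}h_{i,i+1}+\lambda\sum_{i=-L}^{L}\omega_i\mathcal N_i+\beta\left(\mathcal N_{-L}+\mathcal N_L\right)\quad\text{on }\bigotimes_{i=-L}^{L}\mathbb C^2,$$ where $$h_{i,i+1}=\tfrac14\left(1-\sigma^z_i\sigma^z_{i+1}\right)-\tfrac1{4\Delta}\left(\sigma^x_i\sigma^x_{i+1}+\sigma^y_i\sigma^y_{i+1}\right),\qquad \mathcal N_i=\tfrac12\left(1-\sigma^z_i\right),$$ and $\sigma^x_i,\sigma^y_i,\sigma^z_i$ are the Pauli matrices acting on the $i$-th tensor factor (a random XXZ spin chain). Put $\Theta_0=1-\frac1\Delta$. Suppose that Property DL holds on $I=[\Theta_0,\Theta_1]$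 for some $\Theta_1>\Theta_0$; that is, there are constants $C<\infty$ and $m>0$ such that, for all $L\in\mathbb N$ and all $i,j\in[-L,L]\cap\mathbb Z$, $$\mathbb E\left(\sup_{g\in G_I}\left\|\mathcal N_i\,g(H^{(L)})\,\mathcal N_j\right\|_1\right)\le C e^{-m|i-j|},$$ where $\|\cdot\|_1$ is the trace norm and $G_I$ is the set of Borel measurable functions $g:\mathbb R\to\mathbb C$ with $|g|\le\chi_I$. Then $\Theta_1\le2\Theta_0$. Equivalently, $I=I_{1,\delta}:=\left[1-\frac1\Delta,(2-\delta)\left(1-\frac1\Delta\right)\right]$ for some $0\le\delta<1$. -/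

import Mathlib

open MeasureTheory ProbabilityTheory
open scoped Matrix ENNReal

noncomputable section

namespace XXZ

/-! ### Spin configurations and operators on a finite set of sites -/

/-- Spin configurations on a finite set `S` of sites of `ℤ`; at each site `0` is spin up (`e₊`) and
`1` is spin down (`e₋`).  They label the product orthonormal basis of `⨂_{i ∈ S} ℂ²`. -/
abbrev Config (S : Finset ℤ) : Type := S → Fin 2

/-- Operators on the Hilbert space `⨂_{i ∈ S} ℂ²`, as matrices in the product orthonormal basis. -/
abbrev Op (S : Finset ℤ) : Type := Matrix (Config S) (Config S) ℂ

/-- The tensor product `⨂_{j ∈ S} A_j` of one-site operators. -/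
def tensorOp {S : Finset ℤ} (A : S → Matrix (Fin 2) (Fin 2) ℂ) : Op S :=
  Matrix.of fun s t => ∏ j, A j (s j) (t j)

/-- The operator acting as `A` on the factor at site `i ∈ S` and as the identity on all others. -/
def siteOp (S : Finset ℤ) (i : ℤ) (A : Matrix (Fin 2) (Fin 2) ℂ) : Op S :=
  tensorOp fun j => if (j : ℤ) = i then A else 1

/-- Pauli matrix `σˣ`. -/
def σx : Matrix (Fin 2) (Fin 2) ℂ := !![0, 1; 1, 0]

/-- Pauli matrix `σʸ`. -/
def σy : Matrix (Fin 2) (Fin 2) ℂ := !![0, -Complex.I; Complex.I, 0]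

/-- Pauli matrix `σᶻ`. -/
def σz : Matrix (Fin 2) (Fin 2) ℂ := !![1, 0; 0, -1]

/-- The local number operator `𝒩ᵢ = (1 - σᵢᶻ) / 2`. -/
def numOp (S : Finset ℤ) (i : ℤ) : Op S :=
  (1 / 2 : ℝ) • (1 - siteOp S i σz)

/-- The two-site Hamiltonian
`h_{i,k} = (1 - σᵢᶻ σₖᶻ) / 4 - (σᵢˣ σₖˣ + σᵢʸ σₖʸ) / (4 Δ)` (used with `k = i + 1`). -/
def bondOp (Δ : ℝ) (S : Finset ℤ) (i k : ℤ) : Op S :=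
  (1 / 4 : ℝ) • (1 - siteOp S i σz * siteOp S k σz)
    - (1 / (4 * Δ)) • (siteOp S i σx * siteOp S k σx + siteOp S i σy * siteOp S k σy)

/-- The sites `[-L, L] ∩ ℤ`. -/
abbrev box (L : ℕ) : Finset ℤ := Finset.Icc (-(L : ℤ)) L

/-- The finite volume XXZ Hamiltonian `H^{(L)}` on `⨂_{i ∈ [-L, L]} ℂ²`, with field `v`
and boundary term of strength `β`. -/
def hamiltonian (Δ lam β : ℝ) (v : ℤ → ℝ) (L : ℕ) : Op (box L) :=
  ∑ i ∈ Finset.Ico (-(L : ℤ)) L, bondOp Δ (box L) i (i + 1)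
    + lam • ∑ i ∈ box L, v i • numOp (box L) i
    + β • (numOp (box L) (-(L : ℤ)) + numOp (box L) L)

/-! ### Self-adjointness of the finite volume Hamiltonian -/

theorem isHermitian_siteOp (S : Finset ℤ) (i : ℤ) {A : Matrix (Fin 2) (Fin 2) ℂ}
    (hA : A.IsHermitian) : (siteOp S i A).IsHermitian := by
  ext s t
  simp only [siteOp, tensorOp, Matrix.conjTranspose_apply, Matrix.of_apply, star_prod]
  refine Finset.prod_congr rfl fun j _ => ?_
  split_ifs
  · exact hA.apply _ _
  · exact (Matrix.isHermitian_one (n := Fin 2) (α := ℂ)).apply _ _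

theorem tensorOp_mul {S : Finset ℤ} (A B : S → Matrix (Fin 2) (Fin 2) ℂ) :
    tensorOp A * tensorOp B = tensorOp fun j => A j * B j := by
  ext s t
  simp only [tensorOp, Matrix.mul_apply, Matrix.of_apply, ← Finset.prod_mul_distrib]
  rw [Finset.prod_univ_sum]
  simp

theorem siteOp_commute (S : Finset ℤ) {i k : ℤ} (h : i ≠ k) (A B : Matrix (Fin 2) (Fin 2) ℂ) :
    siteOp S i A * siteOp S k B = siteOp S k B * siteOp S i A := by
  simp only [siteOp, tensorOp_mul]
  congr 1
  funext j
  by_cases h1 : (j : ℤ) = i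
  · have h2 : (j : ℤ) ≠ k := fun h2 => h (h1.symm.trans h2)
    simp [h1, h]
  · simp [h1]

theorem isHermitian_σx : σx.IsHermitian := by
  ext i j; fin_cases i <;> fin_cases j <;> simp [σx]

theorem isHermitian_σy : σy.IsHermitian := by
  ext i j; fin_cases i <;> fin_cases j <;> simp [σy]

theorem isHermitian_σz : σz.IsHermitian := by
  ext i j; fin_cases i <;> fin_cases j <;> simp [σz]

theorem isHermitian_smul {n : Type*} {A : Matrix n n ℂ} (hA : A.IsHermitian) (c : ℝ) :
    (c • A).IsHermitian := by
  unfold Matrix.IsHermitian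
  rw [Matrix.conjTranspose_smul, hA.eq, star_trivial]

theorem isHermitian_siteOp_mul (S : Finset ℤ) {i k : ℤ} (h : i ≠ k)
    {A : Matrix (Fin 2) (Fin 2) ℂ} (hA : A.IsHermitian) :
    (siteOp S i A * siteOp S k A).IsHermitian := by
  unfold Matrix.IsHermitian
  rw [Matrix.conjTranspose_mul, (isHermitian_siteOp S i hA).eq, (isHermitian_siteOp S k hA).eq,
    siteOp_commute S h]

theorem isHermitian_numOp (S : Finset ℤ) (i : ℤ) : (numOp S i).IsHermitian :=
  isHermitian_smul (Matrix.isHermitian_one.sub (isHermitian_siteOp S i isHermitian_σz)) _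

theorem isHermitian_bondOp (Δ : ℝ) (S : Finset ℤ) {i k : ℤ} (h : i ≠ k) :
    (bondOp Δ S i k).IsHermitian :=
  (isHermitian_smul (Matrix.isHermitian_one.sub (isHermitian_siteOp_mul S h isHermitian_σz)) _).sub
    (isHermitian_smul ((isHermitian_siteOp_mul S h isHermitian_σx).add
      (isHermitian_siteOp_mul S h isHermitian_σy)) _)

theorem isHermitian_sum {n ι : Type*} (s : Finset ι) (A : ι → Matrix n n ℂ)
    (hA : ∀ i ∈ s, (A i).IsHermitian) : (∑ i ∈ s, A i).IsHermitian := by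
  unfold Matrix.IsHermitian
  rw [Matrix.conjTranspose_sum]
  exact Finset.sum_congr rfl fun i hi => (hA i hi).eq

theorem isHermitian_hamiltonian (Δ lam β : ℝ) (v : ℤ → ℝ) (L : ℕ) :
    (hamiltonian Δ lam β v L).IsHermitian :=
  ((isHermitian_sum _ _ fun i _ => isHermitian_bondOp Δ _ (by omega)).add
    (isHermitian_smul (isHermitian_sum _ _ fun i _ =>
      isHermitian_smul (isHermitian_numOp _ i) _) _)).add
    (isHermitian_smul ((isHermitian_numOp _ _).add (isHermitian_numOp _ _)) _)

/-! ### Functional calculus and trace norm -/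

/-- `g(A)` for a Hermitian matrix `A` and `g : ℝ → ℂ`: with `U` a unitary whose columns are
eigenvectors of `A` with eigenvalues `E₁, E₂, …`, it is `U diag(g(E₁), g(E₂), …) U*`. -/
def funCalc {n : Type*} [Fintype n] [DecidableEq n] {A : Matrix n n ℂ} (hA : A.IsHermitian)
    (g : ℝ → ℂ) : Matrix n n ℂ :=
  (hA.eigenvectorUnitary : Matrix n n ℂ) * Matrix.diagonal (fun k => g (hA.eigenvalues k))
    * (hA.eigenvectorUnitary : Matrix n n ℂ)ᴴ

/-- The trace norm `‖A‖₁ = tr |A|`: the sum of the singular values of `A`, i.e. of the square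
roots of the eigenvalues of `A* A` counted with multiplicity. -/
def traceNorm {n : Type*} [Fintype n] [DecidableEq n] (A : Matrix n n ℂ) : ℝ :=
  ∑ k, Real.sqrt ((Matrix.isHermitian_conjTranspose_mul_self A).eigenvalues k)

/-! ### Disordered and random XXZ spin chains -/

/-- The shift on `ℤ`-indexed real sequences. -/
def shift (x : ℤ → ℝ) : ℤ → ℝ := fun i => x (i + 1)

/-- The data `(Δ, lam, β, ω)` define a disordered XXZ spin chain in the Ising phase: `Δ > 1`,
`lam > 0`, the boundary parameter satisfies `β ≥ (1 - 1/Δ) / 2`, and `ω = (ωᵢ)_{i ∈ ℤ}` are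
identically distributed random variables with shift-ergodic joint distribution, whose single-site
distribution `μ` satisfies `{0, 1} ⊆ supp μ ⊆ [0, 1]` and `μ {0} = 0`. -/
structure IsDisorderedChain {Ω : Type*} [MeasurableSpace Ω] (P : Measure Ω) (ω : ℤ → Ω → ℝ)
    (μ : Measure ℝ) (Δ lam β : ℝ) : Prop where
  one_lt_Δ : 1 < Δ
  lam_pos : 0 < lam
  le_β : (1 / 2) * (1 - 1 / Δ) ≤ β
  measurable_ω : ∀ i, Measurable (ω i)
  law_ω : ∀ i, P.map (ω i) = μ
  ergodic_ω : Ergodic shift (P.map fun x i => ω i x)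
  subset_support : {0, 1} ⊆ μ.support
  support_subset : μ.support ⊆ Set.Icc 0 1
  zero_null : μ {0} = 0

/-- A random XXZ spin chain: a disordered one for which the `ωᵢ` are independent. -/
structure IsRandomChain {Ω : Type*} [MeasurableSpace Ω] (P : Measure Ω) (ω : ℤ → Ω → ℝ)
    (μ : Measure ℝ) (Δ lam β : ℝ) : Prop extends IsDisorderedChain P ω μ Δ lam β where
  indep_ω : iIndepFun ω P

/-- `G_I`: the Borel functions `g : ℝ → ℂ` with `|g| ≤ χ_I`. -/
def G (I : Set ℝ) : Set (ℝ → ℂ) :=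
  {g | Measurable g ∧ ∀ x, ‖g x‖ ≤ I.indicator (fun _ => (1 : ℝ)) x}

/-- The bottom `Θ₀ = 1 - 1/Δ` of the droplet spectrum. -/
def Θ₀ (Δ : ℝ) : ℝ := 1 - 1 / Δ

/-- The interval `I_{1,δ} = [1 - 1/Δ, (2 - δ)(1 - 1/Δ)]`. -/
def dropletInterval (Δ δ : ℝ) : Set ℝ := Set.Icc (1 - 1 / Δ) ((2 - δ) * (1 - 1 / Δ))

/-- Property DL (droplet localization) on the interval `I = [Θ₀, Θ₁]`, where `Θ₁ > Θ₀`: there are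
`C < ∞` and `m > 0` such that, uniformly in `L`,
`𝔼 (sup_{g ∈ G_I} ‖𝒩ᵢ g(H^{(L)}) 𝒩ⱼ‖₁) ≤ C exp(-m |i - j|)` for all `i, j ∈ [-L, L]`. -/
def PropertyDL {Ω : Type*} [MeasurableSpace Ω] (P : Measure Ω) (ω : ℤ → Ω → ℝ)
    (Δ lam β Θ₁ : ℝ) : Prop :=
  Θ₀ Δ < Θ₁ ∧ ∃ C m : ℝ, 0 < m ∧ ∀ L : ℕ, 1 ≤ L → ∀ i ∈ box L, ∀ j ∈ box L,
    ∫⁻ x, (⨆ g ∈ G (Set.Icc (Θ₀ Δ) Θ₁), ENNReal.ofReal (traceNorm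
        (numOp (box L) i * funCalc (isHermitian_hamiltonian Δ lam β (fun k => ω k x) L) g
          * numOp (box L) j))) ∂P
      ≤ ENNReal.ofReal (C * Real.exp (-m * |((i : ℝ) - (j : ℝ))|))

end XXZ

end

/-! Suppose `Θ₁ > 2 Θ₀`. Then `2 Θ₀` is interior to `I`, and it is the least energy of two far-apart
free magnons, each at the bottom `Θ₀` of its band. Give each magnon a tent-shaped profile of fixed
half-width `l`, one centred at `-n`, the other at `n`. If the field is below `ε` on both windows,
this product state is an approximate eigenvector at `2 Θ₀`: the kinetic error is small because the
tent is piecewise linear (`sum_sq_laplacian_tent_le`), the field error because `ε` is small.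

The state therefore overlaps `χ_I(H)`, and `sq_div_le_norm_funCalc_indicator` bounds below the
diagonal entry of `χ_I(H)` at the configuration with down spins at `±n`. Multiplying by `𝒩₋ₙ` and
`𝒩ₙ` keeps that entry, so it bounds the trace norm below (`le_traceNorm_of_small_field`). By
independence and `0 ∈ supp μ`, the quiet windows have probability bounded below independently of
`n`. Hence the expectation in Property DL does not decay in `n`, contradicting `C exp(-2mn)`. -/

noncomputable section

namespace XXZ

/-! ### Approximate eigenvectors and spectral projections of Hermitian matrices -/

section LinearAlgebra

variable {n : Type*} [Fintype n]

theorem sum_norm_sq_eq_dotProduct (φ : n → ℂ) :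
    ((∑ t, ‖φ t‖ ^ 2 : ℝ) : ℂ) = star φ ⬝ᵥ φ := by
  simp [dotProduct, Complex.conj_mul']

theorem norm_sum_mul_le_sqrt (u c : n → ℂ) :
    ‖∑ k, u k * c k‖ ≤ Real.sqrt (∑ k, ‖u k‖ ^ 2) * Real.sqrt (∑ k, ‖c k‖ ^ 2) := by
  refine (norm_sum_le _ _).trans ?_
  simp only [norm_mul]
  exact Real.sum_mul_le_sqrt_mul_sqrt _ _ _

variable [DecidableEq n]

/-- A diagonal matrix entry is bounded by the trace norm. -/
theorem norm_apply_self_le_traceNorm (A : Matrix n n ℂ) (s : n) : ‖A s s‖ ≤ traceNorm A := by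
  set h := Matrix.isHermitian_conjTranspose_mul_self A
  have hnn : ∀ k, 0 ≤ h.eigenvalues k :=
    Matrix.eigenvalues_conjTranspose_mul_self_nonneg A
  have htr : ∑ k, h.eigenvalues k = ∑ t, ∑ r, ‖A r t‖ ^ 2 := by
    have := h.trace_eq_sum_eigenvalues
    have h2 : (Aᴴ * A).trace = ((∑ t, ∑ r, ‖A r t‖ ^ 2 : ℝ) : ℂ) := by
      simp [Matrix.trace, Matrix.mul_apply, Complex.conj_mul']
    rw [h2] at this
    exact Complex.ofReal_injective (by rw [this]; push_cast; rfl)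
  have h1 : ‖A s s‖ ^ 2 ≤ ∑ k, h.eigenvalues k := by
    rw [htr]
    refine le_trans ?_ (Finset.single_le_sum (f := fun t => ∑ r, ‖A r t‖ ^ 2)
      (fun t _ => Finset.sum_nonneg fun r _ => sq_nonneg _) (Finset.mem_univ s))
    exact Finset.single_le_sum (f := fun r => ‖A r s‖ ^ 2) (fun r _ => sq_nonneg _)
      (Finset.mem_univ s)
  -- The Hilbert–Schmidt norm is at most the trace norm, since singular values are nonnegative.
  have h2 : ∑ k, h.eigenvalues k ≤ traceNorm A ^ 2 := by
    calc ∑ k, h.eigenvalues k = ∑ k, Real.sqrt (h.eigenvalues k) ^ 2 :=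
          Finset.sum_congr rfl fun k _ => (Real.sq_sqrt (hnn k)).symm
      _ ≤ _ := Finset.sum_sq_le_sq_sum_of_nonneg fun k _ => Real.sqrt_nonneg _
  refine abs_le_of_sq_le_sq' (h1.trans h2) (Finset.sum_nonneg fun k _ => Real.sqrt_nonneg _) |>.2

theorem sum_norm_sq_unitary_conjTranspose_mulVec (U : Matrix.unitaryGroup n ℂ) (φ : n → ℂ) :
    ∑ k, ‖((U : Matrix n n ℂ)ᴴ *ᵥ φ) k‖ ^ 2 = ∑ t, ‖φ t‖ ^ 2 := by
  have hU : (U : Matrix n n ℂ) * (U : Matrix n n ℂ)ᴴ = 1 := Unitary.coe_mul_star_self U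
  have : ((∑ k, ‖((U : Matrix n n ℂ)ᴴ *ᵥ φ) k‖ ^ 2 : ℝ) : ℂ) = ((∑ t, ‖φ t‖ ^ 2 : ℝ) : ℂ) := by
    rw [sum_norm_sq_eq_dotProduct, sum_norm_sq_eq_dotProduct, Matrix.star_mulVec,
      Matrix.conjTranspose_conjTranspose, ← Matrix.dotProduct_mulVec, Matrix.mulVec_mulVec, hU,
      Matrix.one_mulVec]
  exact_mod_cast this

theorem sum_norm_sq_unitary_row (U : Matrix.unitaryGroup n ℂ) (s : n) :
    ∑ k, ‖(U : Matrix n n ℂ) s k‖ ^ 2 = 1 := by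
  have hU : (U : Matrix n n ℂ) * (U : Matrix n n ℂ)ᴴ = 1 := Unitary.coe_mul_star_self U
  have := congrFun (congrFun hU s) s
  rw [Matrix.mul_apply, Matrix.one_apply_eq] at this
  simp only [Matrix.conjTranspose_apply, RCLike.star_def, Complex.mul_conj'] at this
  exact_mod_cast this

open Classical in
theorem funCalc_indicator_apply_self {A : Matrix n n ℂ} (hA : A.IsHermitian) (I : Set ℝ) (s : n) :
    funCalc hA (I.indicator 1) s s =
      ((∑ k, ‖if hA.eigenvalues k ∈ I then (hA.eigenvectorUnitary : Matrix n n ℂ) s k else 0‖ ^ 2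
        : ℝ) : ℂ) := by
  rw [funCalc, Matrix.mul_apply]
  push_cast
  refine Finset.sum_congr rfl fun k _ => ?_
  rw [Matrix.mul_diagonal, Matrix.conjTranspose_apply, RCLike.star_def, mul_assoc, mul_comm,
    mul_assoc]
  by_cases h : hA.eigenvalues k ∈ I <;> simp [h, Complex.conj_mul']

/-- An approximate eigenvector `ψ` of `A` at energy `E`, well inside `I`, forces the diagonal entry
of the spectral projection `χ_I(A)` to be large where `ψ` is large. -/
theorem sq_div_le_norm_funCalc_indicator {A : Matrix n n ℂ} (hA : A.IsHermitian) {I : Set ℝ}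
    {E d a b M : ℝ} (hd : 0 < d) (hI : ∀ x ∉ I, d ≤ |x - E|) (ψ : n → ℂ) (s : n)
    (ha : a ≤ ‖ψ s‖) (hb : 0 ≤ b) (hba : b ≤ a) (hM : 0 < M)
    (hψ : ∑ t, ‖ψ t‖ ^ 2 ≤ M ^ 2)
    (herr : ∑ t, ‖(A *ᵥ ψ - (E : ℂ) • ψ) t‖ ^ 2 ≤ (d * b) ^ 2) :
    (a - b) ^ 2 / M ^ 2 ≤ ‖funCalc hA (I.indicator 1) s s‖ := by
  classical
  set U := hA.eigenvectorUnitary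
  set u := fun k => (U : Matrix n n ℂ) s k with hu
  set c := (U : Matrix n n ℂ)ᴴ *ᵥ ψ with hc
  have hUU : (U : Matrix n n ℂ) * (U : Matrix n n ℂ)ᴴ = 1 := Unitary.coe_mul_star_self U
  have hUU' : (U : Matrix n n ℂ)ᴴ * (U : Matrix n n ℂ) = 1 := Unitary.coe_star_mul_self U
  have hAU : (U : Matrix n n ℂ)ᴴ * A =
      Matrix.diagonal (fun k => (hA.eigenvalues k : ℂ)) * (U : Matrix n n ℂ)ᴴ := by
    have h := hA.spectral_theorem
    rw [Unitary.conjStarAlgAut_apply] at h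
    have h' : A = (U : Matrix n n ℂ) * Matrix.diagonal (fun k => (hA.eigenvalues k : ℂ))
      * (U : Matrix n n ℂ)ᴴ := h
    calc (U : Matrix n n ℂ)ᴴ * A = (U : Matrix n n ℂ)ᴴ * ((U : Matrix n n ℂ) *
          Matrix.diagonal (fun k => (hA.eigenvalues k : ℂ)) * (U : Matrix n n ℂ)ᴴ) := by rw [← h']
      _ = _ := by rw [← mul_assoc, ← mul_assoc, hUU', one_mul]
  have hψs : ψ s = ∑ k, u k * c k := by
    have : ψ = (U : Matrix n n ℂ) *ᵥ c := by rw [hc, Matrix.mulVec_mulVec, hUU, Matrix.one_mulVec]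
    conv_lhs => rw [this]
    rfl
  have hcM : ∑ k, ‖c k‖ ^ 2 ≤ M ^ 2 := by
    rw [hc, sum_norm_sq_unitary_conjTranspose_mulVec]; exact hψ
  -- In the eigenbasis `A - E` is multiplication by `E_k - E`, and the change of basis preserves the
  -- norm.
  have hres : ∑ k, ‖((hA.eigenvalues k : ℂ) - E) * c k‖ ^ 2 ≤ (d * b) ^ 2 := by
    refine le_trans (le_of_eq ?_) herr
    rw [← sum_norm_sq_unitary_conjTranspose_mulVec U (A *ᵥ ψ - (E : ℂ) • ψ)]
    refine Finset.sum_congr rfl fun k _ => ?_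
    rw [Matrix.mulVec_sub, Matrix.mulVec_mulVec, hAU, ← Matrix.mulVec_mulVec, Matrix.mulVec_smul,
      ← hc, Pi.sub_apply, Matrix.mulVec_diagonal, Pi.smul_apply, smul_eq_mul, sub_mul]
  set cout := fun k => if hA.eigenvalues k ∈ I then 0 else c k with hcout
  set uin := fun k => if hA.eigenvalues k ∈ I then u k else 0 with huin
  -- Chebyshev: outside `I` the multiplier has modulus at least `d`, so a residual of norm `d b`
  -- leaves mass at most `b²` there.
  have hout : ∑ k, ‖cout k‖ ^ 2 ≤ b ^ 2 := by
    have h1 : d ^ 2 * ∑ k, ‖cout k‖ ^ 2 ≤ (d * b) ^ 2 := by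
      refine le_trans ?_ hres
      rw [Finset.mul_sum]
      refine Finset.sum_le_sum fun k _ => ?_
      by_cases h : hA.eigenvalues k ∈ I
      · simp only [hcout, h, if_true, norm_zero, ne_eq, OfNat.ofNat_ne_zero, not_false_eq_true,
          zero_pow, mul_zero]
        positivity
      · simp only [hcout, h, if_false]
        rw [norm_mul, mul_pow]
        have h2 : ‖(hA.eigenvalues k : ℂ) - E‖ = |hA.eigenvalues k - E| := by
          rw [← Complex.ofReal_sub, Complex.norm_real, Real.norm_eq_abs]
        rw [h2]
        have := hI _ h
        gcongr
    rw [mul_pow] at h1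
    exact le_of_mul_le_mul_left h1 (by positivity)
  have hsplit : ψ s = ∑ k, uin k * c k + ∑ k, u k * cout k := by
    rw [hψs, ← Finset.sum_add_distrib]
    refine Finset.sum_congr rfl fun k _ => ?_
    by_cases h : hA.eigenvalues k ∈ I <;> simp [huin, hcout, h]
  have hP : ‖funCalc hA (I.indicator 1) s s‖ = ∑ k, ‖uin k‖ ^ 2 := by
    rw [funCalc_indicator_apply_self, Complex.norm_real, Real.norm_eq_abs, abs_of_nonneg]
    exact Finset.sum_nonneg fun k _ => sq_nonneg _
  have h2 : ‖∑ k, u k * cout k‖ ≤ b := by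
    refine (norm_sum_mul_le_sqrt _ _).trans ?_
    rw [hu, sum_norm_sq_unitary_row, Real.sqrt_one, one_mul]
    exact Real.sqrt_le_iff.2 ⟨hb, hout⟩
  -- The part of `ψ s` inside `I` involves only the projected row of `U`, whose squared norm is the
  -- diagonal entry sought.
  have h3 : ‖∑ k, uin k * c k‖ ≤ Real.sqrt (∑ k, ‖uin k‖ ^ 2) * M := by
    refine (norm_sum_mul_le_sqrt _ _).trans ?_
    gcongr
    exact Real.sqrt_le_iff.2 ⟨hM.le, hcM⟩
  have h4 : a - b ≤ Real.sqrt (∑ k, ‖uin k‖ ^ 2) * M := by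
    have := norm_add_le (∑ k, uin k * c k) (∑ k, u k * cout k)
    rw [← hsplit] at this
    linarith
  rw [hP, div_le_iff₀ (by positivity)]
  calc (a - b) ^ 2 ≤ (Real.sqrt (∑ k, ‖uin k‖ ^ 2) * M) ^ 2 :=
        pow_le_pow_left₀ (by linarith) h4 2
    _ = _ := by rw [mul_pow, Real.sq_sqrt (Finset.sum_nonneg fun k _ => sq_nonneg _)]

end LinearAlgebra

/-! ### Action of the local operators on product basis vectors -/

/-- The product basis vector labelled by the configuration `t`. -/
def basisVec {S : Finset ℤ} (t : Config S) : Config S → ℂ := Pi.single t 1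

theorem siteOp_mulVec_basisVec {S : Finset ℤ} (i : S) (A : Matrix (Fin 2) (Fin 2) ℂ)
    (t : Config S) :
    siteOp S i A *ᵥ basisVec t = ∑ b, A b (t i) • basisVec (Function.update t i b) := by
  ext s
  rw [basisVec, Matrix.mulVec_single_one, Finset.sum_apply, Matrix.col_apply, siteOp, tensorOp,
    Matrix.of_apply]
  simp only [Pi.smul_apply, basisVec, Pi.single_apply, smul_eq_mul, mul_ite, mul_one, mul_zero]
  by_cases h : s = Function.update t i (s i)
  · rw [Finset.sum_eq_single (s i)]
    · rw [if_pos h, Finset.prod_eq_single i]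
      · simp
      · intro j _ hj
        have h1 : s j = t j := by rw [h]; simp [hj]
        have h2 : (j : ℤ) ≠ i := fun h' => hj (Subtype.ext h')
        rw [if_neg h2, h1, Matrix.one_apply_eq]
      · simp
    · intro b _ hb
      refine if_neg fun h' => hb ?_
      rw [h']; simp
    · simp
  · rw [Finset.sum_eq_zero]
    · obtain ⟨j, hj⟩ : ∃ j, s j ≠ Function.update t i (s i) j := Function.ne_iff.1 h
      have hji : j ≠ i := by rintro rfl; simp at hj
      have h2 : (j : ℤ) ≠ i := fun h' => hji (Subtype.ext h')
      refine Finset.prod_eq_zero (Finset.mem_univ j) ?_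
      rw [if_neg h2, Matrix.one_apply_ne]
      simpa [hji] using hj
    · intro b _
      refine if_neg fun h' => h ?_
      have : b = s i := by rw [h']; simp
      rw [← this]; exact h'

theorem numOp_mulVec_basisVec {S : Finset ℤ} (i : S) (t : Config S) :
    numOp S i *ᵥ basisVec t = if t i = 1 then basisVec t else 0 := by
  rw [numOp, Matrix.smul_mulVec, Matrix.sub_mulVec, siteOp_mulVec_basisVec, Matrix.one_mulVec]
  have h : Function.update t i (t i) = t := Function.update_eq_self _ _
  rcases Fin.exists_fin_two.1 ⟨t i, rfl⟩ with h0 | h0 <;> rw [h0] at h ⊢ <;>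
    simp [Fin.sum_univ_two, σz, h]
  rw [← two_smul ℝ, smul_smul]; norm_num

/-- The `σˣσˣ` and `σʸσʸ` terms cancel on equal spins and agree on opposite ones, where each swaps
the spins; hence `1/(4Δ)` becomes `1/(2Δ)`. -/
theorem bondOp_mulVec_basisVec (Δ : ℝ) {S : Finset ℤ} {i k : S} (hik : i ≠ k) (t : Config S) :
    bondOp Δ S i k *ᵥ basisVec t = if t i = t k then 0 else
      (1 / 2 : ℝ) • basisVec t -
        (1 / (2 * Δ)) • basisVec (Function.update (Function.update t i (t k)) k (t i)) := by
  rw [bondOp]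
  simp only [Matrix.smul_mulVec, Matrix.sub_mulVec, Matrix.add_mulVec, ← Matrix.mulVec_mulVec,
    siteOp_mulVec_basisVec, Matrix.one_mulVec, Matrix.mulVec_add, Matrix.mulVec_smul,
    Fin.sum_univ_two, σx, σy, σz]
  have hi : Function.update t i (t i) = t := Function.update_eq_self _ _
  have hk : Function.update t k (t k) = t := Function.update_eq_self _ _
  rcases Fin.exists_fin_two.1 ⟨t i, rfl⟩ with h0 | h0 <;>
  rcases Fin.exists_fin_two.1 ⟨t k, rfl⟩ with h1 | h1 <;>
  rw [h0] at hi <;> rw [h1] at hk <;>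
    simp [hik, h0, h1, hi, hk, Function.update_comm hik.symm, smul_smul]
  all_goals
    ext s
    simp
    ring

/-- The configuration whose down spins are exactly those at `a` and `b`. -/
def pairConfig (S : Finset ℤ) (a b : ℤ) : Config S :=
  fun k => if (k : ℤ) = a ∨ (k : ℤ) = b then 1 else 0

/-- Only bonds with exactly one down spin contribute. As `a + 2 ≤ b`, these are four distinct bonds;
the sum of `if`s is ready to be summed over `k`. -/
theorem bondOp_mulVec_pairConfig (Δ : ℝ) {S : Finset ℤ} {a b k : ℤ} (hab : a + 2 ≤ b)
    (hk : k ∈ S) (hk1 : k + 1 ∈ S) :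
    bondOp Δ S k (k + 1) *ᵥ basisVec (pairConfig S a b) =
      (if k = a - 1 then (1 / 2 : ℝ) • basisVec (pairConfig S a b)
        - (1 / (2 * Δ)) • basisVec (pairConfig S (a - 1) b) else 0)
      + (if k = a then (1 / 2 : ℝ) • basisVec (pairConfig S a b)
        - (1 / (2 * Δ)) • basisVec (pairConfig S (a + 1) b) else 0)
      + (if k = b - 1 then (1 / 2 : ℝ) • basisVec (pairConfig S a b)
        - (1 / (2 * Δ)) • basisVec (pairConfig S a (b - 1)) else 0)
      + (if k = b then (1 / 2 : ℝ) • basisVec (pairConfig S a b)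
        - (1 / (2 * Δ)) • basisVec (pairConfig S a (b + 1)) else 0) := by
  have h := bondOp_mulVec_basisVec Δ (S := S) (i := ⟨k, hk⟩) (k := ⟨k + 1, hk1⟩)
    (by simp [Subtype.ext_iff]) (pairConfig S a b)
  simp only at h
  rw [h]
  have key : ∀ c d : ℤ,
      (∀ j : ℤ, (j = c ∨ j = d) ↔ if j = k + 1 then (k = a ∨ k = b) else
        if j = k then (k + 1 = a ∨ k + 1 = b) else (j = a ∨ j = b)) →
      Function.update (Function.update (pairConfig S a b) ⟨k, hk⟩ (pairConfig S a b ⟨k + 1, hk1⟩))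
        ⟨k + 1, hk1⟩ (pairConfig S a b ⟨k, hk⟩) = pairConfig S c d := by
    intro c d hcd
    funext ⟨j, hj⟩
    have := hcd j
    simp only [Function.update_apply, Subtype.mk.injEq, pairConfig]
    by_cases h1 : j = k + 1
    · rw [if_pos h1] at this ⊢
      exact if_congr this.symm rfl rfl
    · rw [if_neg h1] at this ⊢
      by_cases h2 : j = k
      · rw [if_pos h2] at this ⊢
        exact if_congr this.symm rfl rfl
      · rw [if_neg h2] at this ⊢
        exact if_congr this.symm rfl rfl
  by_cases h1 : k = a - 1
  · have hne : pairConfig S a b ⟨k, hk⟩ ≠ pairConfig S a b ⟨k + 1, hk1⟩ := by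
      simp only [pairConfig]; rw [if_neg (by omega), if_pos (by omega)]; simp
    rw [if_neg hne, key (a - 1) b (fun j => by split_ifs <;> omega), if_pos h1,
      if_neg (by omega), if_neg (by omega), if_neg (by omega)]
    simp
  by_cases h2 : k = a
  · have hne : pairConfig S a b ⟨k, hk⟩ ≠ pairConfig S a b ⟨k + 1, hk1⟩ := by
      simp only [pairConfig]; rw [if_pos (by omega), if_neg (by omega)]; simp
    rw [if_neg hne, key (a + 1) b (fun j => by split_ifs <;> omega), if_neg h1,
      if_pos h2, if_neg (by omega), if_neg (by omega)]
    simp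
  by_cases h3 : k = b - 1
  · have hne : pairConfig S a b ⟨k, hk⟩ ≠ pairConfig S a b ⟨k + 1, hk1⟩ := by
      simp only [pairConfig]; rw [if_neg (by omega), if_pos (by omega)]; simp
    rw [if_neg hne, key a (b - 1) (fun j => by split_ifs <;> omega), if_neg h1,
      if_neg h2, if_pos h3, if_neg (by omega)]
    simp
  by_cases h4 : k = b
  · have hne : pairConfig S a b ⟨k, hk⟩ ≠ pairConfig S a b ⟨k + 1, hk1⟩ := by
      simp only [pairConfig]; rw [if_pos (by omega), if_neg (by omega)]; simp
    rw [if_neg hne, key a (b + 1) (fun j => by split_ifs <;> omega), if_neg h1,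
      if_neg h2, if_neg h3, if_pos h4]
    simp
  · rw [if_pos, if_neg h1, if_neg h2, if_neg h3, if_neg h4]
    · simp
    · simp only [pairConfig]; rw [if_neg (by omega), if_neg (by omega)]

theorem numOp_mulVec_pairConfig {S : Finset ℤ} {a b k : ℤ} (hk : k ∈ S) :
    numOp S k *ᵥ basisVec (pairConfig S a b) =
      if k = a ∨ k = b then basisVec (pairConfig S a b) else 0 := by
  have h := numOp_mulVec_basisVec (S := S) ⟨k, hk⟩ (pairConfig S a b)
  simp only at h
  rw [h]
  exact if_congr (by simp [pairConfig, or_iff_not_imp_left]) rfl rfl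

/-- The action of the Hamiltonian on two isolated magnons away from the boundary. -/
theorem hamiltonian_mulVec_pairConfig (Δ lam β : ℝ) (v : ℤ → ℝ) {L : ℕ} {a b : ℤ}
    (ha : -(L : ℤ) < a) (hab : a + 2 ≤ b) (hb : b < L) :
    hamiltonian Δ lam β v L *ᵥ basisVec (pairConfig (box L) a b) =
      (2 + lam * (v a + v b)) • basisVec (pairConfig (box L) a b) - (1 / (2 * Δ)) •
        (basisVec (pairConfig (box L) (a - 1) b) + basisVec (pairConfig (box L) (a + 1) b)
          + basisVec (pairConfig (box L) a (b - 1)) + basisVec (pairConfig (box L) a (b + 1))) := by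
  -- The diagonal energy `2` is `1/2` from each of the four active bonds.
  have h1 : (∑ k ∈ Finset.Ico (-(L : ℤ)) L, bondOp Δ (box L) k (k + 1)) *ᵥ
      basisVec (pairConfig (box L) a b) =
      (2 : ℝ) • basisVec (pairConfig (box L) a b) - (1 / (2 * Δ)) •
        (basisVec (pairConfig (box L) (a - 1) b) + basisVec (pairConfig (box L) (a + 1) b)
          + basisVec (pairConfig (box L) a (b - 1)) + basisVec (pairConfig (box L) a (b + 1))) := by
    rw [Matrix.sum_mulVec, Finset.sum_congr rfl fun k hk => bondOp_mulVec_pairConfig Δ hab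
      (by simp only [Finset.mem_Ico, Finset.mem_Icc] at hk ⊢; omega)
      (by simp only [Finset.mem_Ico, Finset.mem_Icc] at hk ⊢; omega)]
    simp only [Finset.sum_add_distrib, Finset.sum_ite_eq']
    rw [if_pos (by simp only [Finset.mem_Ico]; omega), if_pos (by simp only [Finset.mem_Ico]; omega),
      if_pos (by simp only [Finset.mem_Ico]; omega), if_pos (by simp only [Finset.mem_Ico]; omega)]
    module
  have h2 : (∑ k ∈ box L, v k • numOp (box L) k) *ᵥ basisVec (pairConfig (box L) a b) =
      (v a + v b) • basisVec (pairConfig (box L) a b) := by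
    rw [Matrix.sum_mulVec]
    have : ∀ k ∈ box L, (v k • numOp (box L) k) *ᵥ basisVec (pairConfig (box L) a b) =
        (if k = a then v k • basisVec (pairConfig (box L) a b) else 0)
          + (if k = b then v k • basisVec (pairConfig (box L) a b) else 0) := by
      intro k hk
      rw [Matrix.smul_mulVec, numOp_mulVec_pairConfig hk]
      by_cases hka : k = a
      · have : k ≠ b := by omega
        simp [hka, show a ≠ b by omega]
      · by_cases hkb : k = b <;> simp [hka, hkb, show b ≠ a by omega]
    rw [Finset.sum_congr rfl this, Finset.sum_add_distrib, Finset.sum_ite_eq', Finset.sum_ite_eq',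
      if_pos (by simp only [Finset.mem_Icc]; omega), if_pos (by simp only [Finset.mem_Icc]; omega),
      add_smul]
  have h3 : (numOp (box L) (-(L : ℤ)) + numOp (box L) L) *ᵥ basisVec (pairConfig (box L) a b)
      = 0 := by
    rw [Matrix.add_mulVec, numOp_mulVec_pairConfig (by simp), numOp_mulVec_pairConfig (by simp),
      if_neg (by omega), if_neg (by omega), add_zero]
  rw [hamiltonian, Matrix.add_mulVec, Matrix.add_mulVec, Matrix.smul_mulVec, Matrix.smul_mulVec,
    h1, h2, h3]
  module

theorem pairConfig_injective_of_lt {S : Finset ℤ} {a b c d : ℤ} (ha : a ∈ S) (hb : b ∈ S)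
    (hc : c ∈ S) (hd : d ∈ S) (hab : a < b) (hcd : c < d)
    (h : pairConfig S a b = pairConfig S c d) : a = c ∧ b = d := by
  have key : ∀ k ∈ S, (k = a ∨ k = b) ↔ (k = c ∨ k = d) := by
    intro k hk
    have := congrFun h ⟨k, hk⟩
    simp only [pairConfig] at this
    split_ifs at this <;> simp_all
  have := key a ha
  have := key b hb
  have := key c hc
  have := key d hd
  omega

/-- Parseval for linear combinations of distinct product basis vectors. -/
theorem sum_norm_sq_sum_smul_basisVec {S : Finset ℤ} {ι : Type*} (T : Finset ι) (t : ι → Config S)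
    (ht : Set.InjOn t T) (c : ι → ℝ) :
    ∑ s, ‖(∑ p ∈ T, c p • basisVec (t p)) s‖ ^ 2 = ∑ p ∈ T, c p ^ 2 := by
  classical
  have hval : ∀ p ∈ T, (∑ q ∈ T, c q • basisVec (t q)) (t p) = c p := by
    intro p hp
    rw [Finset.sum_apply, Finset.sum_eq_single p]
    · simp [basisVec]
    · intro q hq hqp
      have : t p ≠ t q := fun h => hqp (ht hq hp h.symm)
      simp [basisVec, this]
    · exact fun h => absurd hp h
  rw [← Finset.sum_subset (Finset.subset_univ (T.image t)), Finset.sum_image ht]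
  · refine Finset.sum_congr rfl fun p hp => ?_
    rw [hval p hp, Complex.norm_real, Real.norm_eq_abs, sq_abs]
  · intro s _ hs
    rw [Finset.sum_apply, Finset.sum_eq_zero]
    · simp
    · intro q hq
      have : s ≠ t q := fun h => hs (Finset.mem_image.2 ⟨q, hq, h.symm⟩)
      simp [basisVec, this]

theorem numOp_eq_diagonal {S : Finset ℤ} (i : S) :
    numOp S i = Matrix.diagonal fun t => if t i = 1 then 1 else 0 := by
  ext s t
  have h := congrFun (numOp_mulVec_basisVec i t) s
  rw [basisVec, Matrix.mulVec_single_one, Matrix.col_apply] at h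
  rw [h, Matrix.diagonal_apply]
  by_cases hst : s = t
  · subst hst; rw [if_pos rfl]; split_ifs <;> simp
  · rw [if_neg hst]; split_ifs <;> simp [hst]

/-- Both number operators are diagonal with value `1` on a configuration that is down at `x` and at
`y`. -/
theorem numOp_mul_mul_numOp_apply_pairConfig {S : Finset ℤ} {x y : ℤ} (hx : x ∈ S) (hy : y ∈ S)
    (A : Op S) :
    (numOp S x * A * numOp S y) (pairConfig S x y) (pairConfig S x y) =
      A (pairConfig S x y) (pairConfig S x y) := by
  rw [numOp_eq_diagonal ⟨x, hx⟩, numOp_eq_diagonal ⟨y, hy⟩, Matrix.mul_diagonal,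
    Matrix.diagonal_mul]
  simp [pairConfig]

/-! ### Tent functions -/

/-- The tent function of half-width and height `l` centred at `0`. -/
def tent (l : ℕ) (a : ℤ) : ℝ := ((max 0 ((l : ℤ) - |a|) : ℤ) : ℝ)

theorem tent_zero (l : ℕ) : tent l 0 = l := by simp [tent]

theorem tent_nonneg (l : ℕ) (a : ℤ) : 0 ≤ tent l a := by
  unfold tent; exact_mod_cast le_max_left _ _

theorem tent_le (l : ℕ) (a : ℤ) : tent l a ≤ l := by
  unfold tent
  have : max 0 ((l : ℤ) - |a|) ≤ l := by have := abs_nonneg a; omega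
  exact_mod_cast this

theorem tent_eq_zero {l : ℕ} {a : ℤ} (h : (l : ℤ) ≤ |a|) : tent l a = 0 := by
  unfold tent
  rw [max_eq_left (by omega), Int.cast_zero]

/-- A crude count of terms suffices: only the order `l³` matters. -/
theorem sum_tent_sq_le (l : ℕ) :
    ∑ a ∈ Finset.Icc (-(l : ℤ)) l, tent l a ^ 2 ≤ (2 * l + 1) * (l : ℝ) ^ 2 := by
  have h := Finset.sum_le_card_nsmul (Finset.Icc (-(l : ℤ)) l) (fun a => tent l a ^ 2)
    ((l : ℝ) ^ 2) fun a _ => pow_le_pow_left₀ (tent_nonneg l a) (tent_le l a) 2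
  refine h.trans (le_of_eq ?_)
  have : (Finset.Icc (-(l : ℤ)) l).card = 2 * l + 1 := by simp; omega
  rw [this, nsmul_eq_mul]; push_cast; ring

/-- The tent is piecewise linear, so its second difference vanishes away from the kinks `0` and
`±l`, and is at most `2` in modulus there. -/
theorem sq_laplacian_tent_le (l : ℕ) (a : ℤ) :
    (tent l (a + 1) + tent l (a - 1) - 2 * tent l a) ^ 2 ≤
      (if a = 0 then 4 else 0) + (if a = l then 4 else 0) + (if a = -(l : ℤ) then 4 else 0) := by
  have h : max 0 ((l : ℤ) - |a + 1|) + max 0 ((l : ℤ) - |a - 1|) - 2 * max 0 ((l : ℤ) - |a|) = 0 ∨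
      ((a = 0 ∨ a = l ∨ a = -(l : ℤ)) ∧
      -2 ≤ max 0 ((l : ℤ) - |a + 1|) + max 0 ((l : ℤ) - |a - 1|) - 2 * max 0 ((l : ℤ) - |a|) ∧
      max 0 ((l : ℤ) - |a + 1|) + max 0 ((l : ℤ) - |a - 1|) - 2 * max 0 ((l : ℤ) - |a|) ≤ 2) := by
    rcases abs_cases a with h1 | h1 <;> rcases abs_cases (a + 1) with h2 | h2 <;>
      rcases abs_cases (a - 1) with h3 | h3 <;> omega
  have e : tent l (a + 1) + tent l (a - 1) - 2 * tent l a = ((max 0 ((l : ℤ) - |a + 1|)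
      + max 0 ((l : ℤ) - |a - 1|) - 2 * max 0 ((l : ℤ) - |a|) : ℤ) : ℝ) := by
    unfold tent; push_cast; ring
  rw [e]
  generalize max 0 ((l : ℤ) - |a + 1|) + max 0 ((l : ℤ) - |a - 1|)
    - 2 * max 0 ((l : ℤ) - |a|) = m at h ⊢
  rcases h with rfl | ⟨h, h1, h2⟩
  · have : ∀ p : Prop, [Decidable p] → (0 : ℝ) ≤ if p then 4 else 0 := by
      intro p _; split_ifs <;> norm_num
    rw [Int.cast_zero]
    have h1 := this (a = 0)
    have h2 := this (a = l)
    have h3 := this (a = -(l : ℤ))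
    linarith
  · have h3 : (m : ℝ) ^ 2 ≤ 4 := by
      have : m ^ 2 ≤ 4 := by nlinarith
      exact_mod_cast this
    refine h3.trans ?_
    rcases h with h | h | h <;> rw [if_pos h] <;> split_ifs <;> norm_num

/-- The bound is uniform in `l`, whereas the squared norm of the tent grows like `l³`; this gap
makes the kinetic error negligible. -/
theorem sum_sq_laplacian_tent_le (l : ℕ) :
    ∑ a ∈ Finset.Icc (-(l : ℤ)) l, (tent l (a + 1) + tent l (a - 1) - 2 * tent l a) ^ 2 ≤ 12 := by
  refine (Finset.sum_le_sum fun a _ => sq_laplacian_tent_le l a).trans ?_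
  simp only [Finset.sum_add_distrib, Finset.sum_ite_eq']
  split_ifs <;> norm_num

/-! ### Summation by parts -/

section Shift

variable {V : Type*} [AddCommGroup V] [Module ℝ V]

/-- Since `f` already vanishes at `±l`, the shift creates no boundary terms and the window stays the
same. -/
theorem sum_smul_comp_add_one {l : ℕ} {f : ℤ → ℝ} (hf : ∀ a : ℤ, (l : ℤ) ≤ |a| → f a = 0)
    (E : ℤ → V) :
    ∑ a ∈ Finset.Icc (-(l : ℤ)) l, f a • E (a + 1) =
      ∑ a ∈ Finset.Icc (-(l : ℤ)) l, f (a - 1) • E a := by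
  refine Finset.sum_bij_ne_zero (fun a _ _ => a + 1) ?_ ?_ ?_ ?_
  · intro a _ h
    have : ¬ (l : ℤ) ≤ |a| := fun h' => h (by rw [hf a h', zero_smul])
    have := abs_lt.1 (not_le.1 this)
    simp only [Finset.mem_Icc]; omega
  · intro a _ _ b _ _ h; omega
  · intro a _ h
    have h' : ¬ (l : ℤ) ≤ |a - 1| := fun h' => h (by rw [hf _ h', zero_smul])
    have := abs_lt.1 (not_le.1 h')
    exact ⟨a - 1, by simp only [Finset.mem_Icc]; omega, by simpa using h, by omega⟩
  · intro a _ _; simp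

theorem sum_smul_comp_sub_one {l : ℕ} {f : ℤ → ℝ} (hf : ∀ a : ℤ, (l : ℤ) ≤ |a| → f a = 0)
    (E : ℤ → V) :
    ∑ a ∈ Finset.Icc (-(l : ℤ)) l, f a • E (a - 1) =
      ∑ a ∈ Finset.Icc (-(l : ℤ)) l, f (a + 1) • E a := by
  refine Finset.sum_bij_ne_zero (fun a _ _ => a - 1) ?_ ?_ ?_ ?_
  · intro a _ h
    have : ¬ (l : ℤ) ≤ |a| := fun h' => h (by rw [hf a h', zero_smul])
    have := abs_lt.1 (not_le.1 this)
    simp only [Finset.mem_Icc]; omega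
  · intro a _ _ b _ _ h; omega
  · intro a _ h
    have h' : ¬ (l : ℤ) ≤ |a + 1| := fun h' => h (by rw [hf _ h', zero_smul])
    have := abs_lt.1 (not_le.1 h')
    exact ⟨a + 1, by simp only [Finset.mem_Icc]; omega, by simpa using h, by omega⟩
  · intro a _ _; simp

theorem sum_sum_smul_neighbours {l : ℕ} {f : ℤ → ℝ} (hf : ∀ a : ℤ, (l : ℤ) ≤ |a| → f a = 0)
    (E : ℤ → ℤ → V) :
    ∑ a ∈ Finset.Icc (-(l : ℤ)) l, ∑ b ∈ Finset.Icc (-(l : ℤ)) l,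
        (f a * f b) • (E (a - 1) b + E (a + 1) b + E a (b - 1) + E a (b + 1)) =
      ∑ a ∈ Finset.Icc (-(l : ℤ)) l, ∑ b ∈ Finset.Icc (-(l : ℤ)) l,
        ((f (a + 1) + f (a - 1)) * f b + f a * (f (b + 1) + f (b - 1))) • E a b := by
  simp only [smul_add, add_mul, mul_add, add_smul, Finset.sum_add_distrib, mul_smul,
    ← Finset.smul_sum]
  rw [sum_smul_comp_sub_one hf fun a => ∑ b ∈ Finset.Icc (-(l : ℤ)) l, f b • E a b,
    sum_smul_comp_add_one hf fun a => ∑ b ∈ Finset.Icc (-(l : ℤ)) l, f b • E a b]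
  simp only [sum_smul_comp_sub_one hf, sum_smul_comp_add_one hf]
  abel

end Shift

/-! ### The two-magnon trial state -/

theorem sum_product_mul_eq (A B : Finset ℤ) (f g : ℤ → ℝ) :
    ∑ p ∈ A ×ˢ B, f p.1 * g p.2 = (∑ a ∈ A, f a) * ∑ b ∈ B, g b := by
  rw [Finset.sum_mul_sum, Finset.sum_product]

/-- Two independent tent-shaped magnons, centred at `x` and `y`. -/
def trialState (S : Finset ℤ) (l : ℕ) (x y : ℤ) : Config S → ℂ :=
  ∑ p ∈ Finset.Icc (-(l : ℤ)) l ×ˢ Finset.Icc (-(l : ℤ)) l,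
    (tent l p.1 * tent l p.2) • basisVec (pairConfig S (x + p.1) (y + p.2))

/-- The coefficients of `(H - 2 Θ₀) ψ` for the trial state `ψ`. -/
def residualCoeff (Δ lam : ℝ) (v : ℤ → ℝ) (l : ℕ) (x y : ℤ) (p : ℤ × ℤ) : ℝ :=
  lam * (v (x + p.1) + v (y + p.2)) * (tent l p.1 * tent l p.2)
    - 1 / (2 * Δ) * ((tent l (p.1 + 1) + tent l (p.1 - 1) - 2 * tent l p.1) * tent l p.2
      + tent l p.1 * (tent l (p.2 + 1) + tent l (p.2 - 1) - 2 * tent l p.2))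

/-- Summation by parts moves the hopping onto the coefficients. Writing each neighbour sum as
Laplacian plus `2 f` leaves the constant `2 - 4/(2Δ) = 2 Θ₀`. The windows avoid the boundary and
keep the magnons two sites apart. -/
theorem hamiltonian_mulVec_trialState_sub (Δ lam β : ℝ) (v : ℤ → ℝ) {L l : ℕ} {x y : ℤ}
    (hx : -(L : ℤ) < x - l) (hxy : x + l + 2 ≤ y - l) (hy : y + l < L) :
    hamiltonian Δ lam β v L *ᵥ trialState (box L) l x y
        - ((2 * Θ₀ Δ : ℝ) : ℂ) • trialState (box L) l x y =
      ∑ p ∈ Finset.Icc (-(l : ℤ)) l ×ˢ Finset.Icc (-(l : ℤ)) l,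
        residualCoeff Δ lam v l x y p • basisVec (pairConfig (box L) (x + p.1) (y + p.2)) := by
  set E : ℤ → ℤ → (Config (box L) → ℂ) := fun a b =>
    basisVec (pairConfig (box L) (x + a) (y + b)) with hE
  have hH : ∀ p ∈ Finset.Icc (-(l : ℤ)) l ×ˢ Finset.Icc (-(l : ℤ)) l,
      hamiltonian Δ lam β v L *ᵥ ((tent l p.1 * tent l p.2) • E p.1 p.2) =
      (tent l p.1 * tent l p.2) • ((2 + lam * (v (x + p.1) + v (y + p.2))) • E p.1 p.2
        - (1 / (2 * Δ)) • (E (p.1 - 1) p.2 + E (p.1 + 1) p.2 + E p.1 (p.2 - 1)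
          + E p.1 (p.2 + 1))) := by
    intro p hp
    simp only [Finset.mem_product, Finset.mem_Icc] at hp
    rw [Matrix.mulVec_smul]
    simp only [hE]
    rw [hamiltonian_mulVec_pairConfig Δ lam β v (by omega) (by omega) (by omega)]
    simp only [add_sub_assoc, add_assoc]
  have hN := sum_sum_smul_neighbours (l := l) (f := tent l) (fun a h => tent_eq_zero h) E
  rw [← Finset.sum_product', ← Finset.sum_product'] at hN
  rw [trialState, Matrix.mulVec_sum, Finset.sum_congr rfl hH, Complex.coe_smul]
  simp only [smul_sub, Finset.sum_sub_distrib, smul_comm _ (1 / (2 * Δ)), ← Finset.smul_sum]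
  rw [hN, Finset.smul_sum, Finset.smul_sum, ← Finset.sum_sub_distrib, ← Finset.sum_sub_distrib]
  refine Finset.sum_congr rfl fun p _ => ?_
  simp only [hE, smul_smul, ← sub_smul]
  congr 1
  rw [residualCoeff, Θ₀]
  ring

theorem injOn_pairConfig {S : Finset ℤ} {l : ℕ} {x y : ℤ} (hxy : x + l < y - l)
    (hS : Finset.Icc (x - l) (y + l) ⊆ S) :
    Set.InjOn (fun p : ℤ × ℤ => pairConfig S (x + p.1) (y + p.2))
      (Finset.Icc (-(l : ℤ)) l ×ˢ Finset.Icc (-(l : ℤ)) l : Finset (ℤ × ℤ)) := by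
  intro p hp q hq h
  simp only [Finset.coe_product, Finset.coe_Icc, Set.mem_prod, Set.mem_Icc] at hp hq
  have := pairConfig_injective_of_lt (hS (Finset.mem_Icc.2 (by omega)))
    (hS (Finset.mem_Icc.2 (by omega))) (hS (Finset.mem_Icc.2 (by omega)))
    (hS (Finset.mem_Icc.2 (by omega))) (by omega) (by omega) h
  exact Prod.ext (by omega) (by omega)

theorem trialState_apply_center {S : Finset ℤ} {l : ℕ} {x y : ℤ} (hxy : x + l < y - l)
    (hS : Finset.Icc (x - l) (y + l) ⊆ S) :
    trialState S l x y (pairConfig S x y) = ((l : ℝ) ^ 2 : ℝ) := by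
  rw [trialState, Finset.sum_apply, Finset.sum_eq_single (0, 0)]
  · simp [basisVec, tent_zero, sq]
  · intro q hq hq0
    have : pairConfig S x y ≠ pairConfig S (x + q.1) (y + q.2) := by
      intro h
      refine hq0 (injOn_pairConfig hxy hS hq (by simp) ?_)
      simp [h]
    simp [basisVec, this]
  · simp

theorem sum_norm_sq_trialState_le {S : Finset ℤ} {l : ℕ} {x y : ℤ} (hxy : x + l < y - l)
    (hS : Finset.Icc (x - l) (y + l) ⊆ S) :
    ∑ s, ‖trialState S l x y s‖ ^ 2 ≤ ((2 * l + 1) * (l : ℝ) ^ 2) ^ 2 := by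
  rw [trialState, sum_norm_sq_sum_smul_basisVec _ _ (injOn_pairConfig hxy hS)]
  simp only [mul_pow (tent _ _)]
  rw [sum_product_mul_eq _ _ (fun a => tent l a ^ 2) fun a => tent l a ^ 2, ← sq]
  exact pow_le_pow_left₀ (Finset.sum_nonneg fun _ _ => sq_nonneg _) (sum_tent_sq_le l) 2

theorem sum_sq_residualCoeff_le {Δ lam ε : ℝ} (hΔ : 1 < Δ) {v : ℤ → ℝ} {l : ℕ} {x y : ℤ}
    (hvx : ∀ a ∈ Finset.Icc (-(l : ℤ)) l, |v (x + a)| ≤ ε)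
    (hvy : ∀ a ∈ Finset.Icc (-(l : ℤ)) l, |v (y + a)| ≤ ε) :
    ∑ p ∈ Finset.Icc (-(l : ℤ)) l ×ˢ Finset.Icc (-(l : ℤ)) l, residualCoeff Δ lam v l x y p ^ 2 ≤
      72 * ((2 * l + 1) * (l : ℝ) ^ 2) + 12 * lam ^ 2 * ε ^ 2 * ((2 * l + 1) * (l : ℝ) ^ 2) ^ 2 := by
  set D : ℤ → ℝ := fun a => tent l (a + 1) + tent l (a - 1) - 2 * tent l a with hD
  set B := Finset.Icc (-(l : ℤ)) l
  set N := (2 * l + 1) * (l : ℝ) ^ 2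
  have hpt : ∀ p ∈ B ×ˢ B, residualCoeff Δ lam v l x y p ^ 2 ≤
      3 * (D p.1 ^ 2 * tent l p.2 ^ 2 + tent l p.1 ^ 2 * D p.2 ^ 2)
        + 12 * lam ^ 2 * ε ^ 2 * (tent l p.1 ^ 2 * tent l p.2 ^ 2) := by
    intro p hp
    rw [Finset.mem_product] at hp
    have h1 := hvx _ hp.1
    have h2 := hvy _ hp.2
    have hv : (v (x + p.1) + v (y + p.2)) ^ 2 ≤ 4 * ε ^ 2 := by
      have : |v (x + p.1) + v (y + p.2)| ≤ 2 * ε := (abs_add_le _ _).trans (by linarith)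
      calc _ ≤ (2 * ε) ^ 2 := sq_le_sq' (abs_le.1 this).1 (abs_le.1 this).2
        _ = _ := by ring
    have hk : (1 / (2 * Δ)) ^ 2 ≤ 1 := by
      have h0 : 0 ≤ 1 / (2 * Δ) := by positivity
      have h1 : 1 / (2 * Δ) ≤ 1 := by rw [div_le_one (by linarith)]; linarith
      exact pow_le_one₀ h0 h1
    have e : residualCoeff Δ lam v l x y p =
      lam * (v (x + p.1) + v (y + p.2)) * (tent l p.1 * tent l p.2)
        - 1 / (2 * Δ) * (D p.1 * tent l p.2 + tent l p.1 * D p.2) := rfl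
    rw [e]
    generalize 1 / (2 * Δ) = k at hk
    generalize v (x + p.1) + v (y + p.2) = w at hv
    generalize tent l p.1 = t, tent l p.2 = u, D p.1 = d, D p.2 = e
    -- Cauchy–Schwarz for three terms gives the factor `3`; the final constants are `72 = 3 · (12 +
    -- 12)` and `12 = 3 · 4`.
    calc (lam * w * (t * u) - k * (d * u + t * e)) ^ 2
        ≤ 3 * ((lam * w * (t * u)) ^ 2 + (k * (d * u)) ^ 2 + (k * (t * e)) ^ 2) := by
          nlinarith [sq_nonneg (lam * w * (t * u) + k * (d * u)),
            sq_nonneg (lam * w * (t * u) + k * (t * e)), sq_nonneg (k * (d * u) - k * (t * e))]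
      _ = 3 * (k ^ 2 * (d ^ 2 * u ^ 2 + t ^ 2 * e ^ 2)) + 3 * (lam ^ 2 * w ^ 2 * (t ^ 2 * u ^ 2)) := by
          ring
      _ ≤ 3 * (1 * (d ^ 2 * u ^ 2 + t ^ 2 * e ^ 2))
          + 3 * (lam ^ 2 * (4 * ε ^ 2) * (t ^ 2 * u ^ 2)) := by gcongr
      _ = _ := by ring
  refine (Finset.sum_le_sum hpt).trans ?_
  rw [Finset.sum_add_distrib, ← Finset.mul_sum, ← Finset.mul_sum, Finset.sum_add_distrib,
    sum_product_mul_eq _ _ (fun a => D a ^ 2) fun a => tent l a ^ 2,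
    sum_product_mul_eq _ _ (fun a => tent l a ^ 2) fun a => D a ^ 2,
    sum_product_mul_eq _ _ (fun a => tent l a ^ 2) fun a => tent l a ^ 2]
  have hT : ∑ a ∈ B, tent l a ^ 2 ≤ N := sum_tent_sq_le l
  have hT0 : 0 ≤ ∑ a ∈ B, tent l a ^ 2 := Finset.sum_nonneg fun _ _ => sq_nonneg _
  have hL : ∑ a ∈ B, D a ^ 2 ≤ 12 := sum_sq_laplacian_tent_le l
  have hL0 : 0 ≤ ∑ a ∈ B, D a ^ 2 := Finset.sum_nonneg fun _ _ => sq_nonneg _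
  have hN : 0 ≤ N := hT0.trans hT
  calc _ ≤ 3 * (12 * N + N * 12) + 12 * lam ^ 2 * ε ^ 2 * (N * N) := by gcongr
    _ = _ := by ring

/-- Lower bound on `‖𝒩ₓ χ_I(H) 𝒩_y‖₁` for an environment that is nearly free of disorder close to
`x` and `y`. -/
theorem le_traceNorm_of_small_field {Δ lam β ε d : ℝ} (hΔ : 1 < Δ) {I : Set ℝ} (hd : 0 < d)
    (hI : ∀ E ∉ I, d ≤ |E - 2 * Θ₀ Δ|) {v : ℤ → ℝ} {L l : ℕ} (hl : 0 < l) {x y : ℤ}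
    (hx : -(L : ℤ) < x - l) (hxy : x + l + 2 ≤ y - l) (hy : y + l < L)
    (hvx : ∀ a ∈ Finset.Icc (-(l : ℤ)) l, |v (x + a)| ≤ ε)
    (hvy : ∀ a ∈ Finset.Icc (-(l : ℤ)) l, |v (y + a)| ≤ ε)
    (hsmall : 72 * ((2 * l + 1) * (l : ℝ) ^ 2)
      + 12 * lam ^ 2 * ε ^ 2 * ((2 * l + 1) * (l : ℝ) ^ 2) ^ 2 ≤ (d * ((l : ℝ) ^ 2 / 2)) ^ 2) :
    1 / (4 * (2 * l + 1) ^ 2 : ℝ) ≤ traceNorm (numOp (box L) x *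
      funCalc (isHermitian_hamiltonian Δ lam β v L) (I.indicator 1) * numOp (box L) y) := by
  have hl' : (0 : ℝ) < l := by exact_mod_cast hl
  have hS : Finset.Icc (x - l) (y + l) ⊆ box L := Finset.Icc_subset_Icc (by omega) (by omega)
  have hxL : x ∈ box L := Finset.mem_Icc.2 (by omega)
  have hyL : y ∈ box L := Finset.mem_Icc.2 (by omega)
  refine le_trans ?_ (norm_apply_self_le_traceNorm _ (pairConfig (box L) x y))
  rw [numOp_mul_mul_numOp_apply_pairConfig hxL hyL]
  have hcenter := trialState_apply_center (l := l) (x := x) (y := y) (by omega) hS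
  -- With `b = a/2`, the bound `(a - b)²/M²` equals `1/(4(2l+1)²)`.
  refine le_trans (le_of_eq ?_) (sq_div_le_norm_funCalc_indicator
    (isHermitian_hamiltonian Δ lam β v L) hd hI (trialState (box L) l x y)
    (pairConfig (box L) x y) (a := (l : ℝ) ^ 2) (b := (l : ℝ) ^ 2 / 2)
    (M := (2 * l + 1) * (l : ℝ) ^ 2) ?_ (by positivity) ?_ (by positivity)
    (sum_norm_sq_trialState_le (by omega) hS) ?_)
  · field_simp; ring
  · rw [hcenter, Complex.norm_real]; exact Real.le_norm_self _
  · have : (0 : ℝ) ≤ (l : ℝ) ^ 2 := by positivity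
    linarith
  · rw [hamiltonian_mulVec_trialState_sub Δ lam β v hx hxy hy,
      sum_norm_sq_sum_smul_basisVec _ _ (injOn_pairConfig (by omega) hS)]
    exact (sum_sq_residualCoeff_le hΔ hvx hvy).trans hsmall

/-! ### Choice of parameters and probability of a quiet environment -/

theorem indicator_one_mem_G {I : Set ℝ} (hI : MeasurableSet I) : I.indicator 1 ∈ G I := by
  refine ⟨measurable_one.indicator hI, fun x => ?_⟩
  by_cases h : x ∈ I <;> simp [h]

/-- Independent variables are simultaneously small on a finite set of sites with a probability that
depends only on a bound for the number of sites. -/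
theorem pow_le_measure_forall_abs_lt {Ω : Type*} [MeasurableSpace Ω] {P : Measure Ω}
    [IsProbabilityMeasure P] {ω : ℤ → Ω → ℝ} {μ : Measure ℝ} (hω : ∀ i, Measurable (ω i))
    (hlaw : ∀ i, P.map (ω i) = μ) (hind : iIndepFun ω P) (ε : ℝ) {T : Finset ℤ} {m : ℕ}
    (hT : T.card ≤ m) : μ (Metric.ball 0 ε) ^ m ≤ P {x | ∀ k ∈ T, |ω k x| < ε} := by
  have hset : {x | ∀ k ∈ T, |ω k x| < ε} = ⋂ k ∈ T, ω k ⁻¹' Metric.ball 0 ε := by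
    ext x; simp
  have hk : ∀ k, P (ω k ⁻¹' Metric.ball 0 ε) = μ (Metric.ball 0 ε) := fun k => by
    rw [← hlaw k, Measure.map_apply (hω k) Metric.isOpen_ball.measurableSet]
  have hq : μ (Metric.ball 0 ε) ≤ 1 := by rw [← hk 0]; exact prob_le_one
  rw [hset, hind.measure_inter_preimage_eq_mul T
    (fun _ _ => Metric.isOpen_ball.measurableSet), Finset.prod_congr rfl fun k _ => hk k,
    Finset.prod_const]
  exact pow_le_pow_right_of_le_one' hq hT

/-- The kinetic error is of order `l³` against `l⁴` on the right, so `l` is fixed first; `ε` is then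
chosen small depending on `l`. -/
theorem exists_tent_parameters (lam : ℝ) {d : ℝ} (hd : 0 < d) :
    ∃ (l : ℕ) (ε : ℝ), 0 < l ∧ 0 < ε ∧ 72 * ((2 * l + 1) * (l : ℝ) ^ 2)
      + 12 * lam ^ 2 * ε ^ 2 * ((2 * l + 1) * (l : ℝ) ^ 2) ^ 2 ≤ (d * ((l : ℝ) ^ 2 / 2)) ^ 2 := by
  -- `72 (2l+1) l² ≤ 216 l³`, and `1728 = 8 · 216` makes this at most `d² l⁴/8`, half of the
  -- allowance.
  obtain ⟨l, hl⟩ := exists_nat_ge (1728 / d ^ 2)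
  have hl0 : (0 : ℝ) < l := lt_of_lt_of_le (by positivity) hl
  have hl1 : (1 : ℝ) ≤ l := by exact_mod_cast (Nat.cast_pos.1 hl0)
  rw [div_le_iff₀ (by positivity)] at hl
  set N := (2 * l + 1) * (l : ℝ) ^ 2 with hN
  have hN0 : 0 < N := by positivity
  have hlam : 0 < |lam| + 1 := by positivity
  -- The `10` works because `12/100 ≤ 1/8`; `|lam| + 1` dominates `|lam|` and is never zero.
  refine ⟨l, d * l ^ 2 / (10 * (|lam| + 1) * N), Nat.cast_pos.1 hl0, by positivity, ?_⟩
  have h1 : 72 * N ≤ d ^ 2 * l ^ 4 / 8 := by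
    have h3 : 72 * N ≤ 216 * l * l ^ 2 := by rw [hN]; nlinarith [sq_nonneg (l : ℝ)]
    have h4 : 1728 * ((l : ℝ) ^ 3) ≤ l * d ^ 2 * l ^ 3 := by gcongr
    linarith
  have h2 : 12 * lam ^ 2 * (d * l ^ 2 / (10 * (|lam| + 1) * N)) ^ 2 * N ^ 2
      ≤ d ^ 2 * l ^ 4 / 8 := by
    have e : 12 * lam ^ 2 * (d * l ^ 2 / (10 * (|lam| + 1) * N)) ^ 2 * N ^ 2
        = (lam ^ 2 / (|lam| + 1) ^ 2) * (12 / 100 * (d ^ 2 * l ^ 4)) := by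
      field_simp; ring
    have h5 : lam ^ 2 / (|lam| + 1) ^ 2 ≤ 1 := by
      rw [div_le_one (by positivity), ← sq_abs lam]
      gcongr
      linarith
    rw [e]
    have h6 : 0 ≤ d ^ 2 * (l : ℝ) ^ 4 := by positivity
    nlinarith
  calc _ ≤ d ^ 2 * l ^ 4 / 8 + d ^ 2 * l ^ 4 / 8 := add_le_add h1 h2
    _ = _ := by ring

/-- If the interval reaches beyond `2 Θ₀`, the quantity in Property DL for sites `-n` and `n` of a
large enough box is bounded below uniformly in `n`. -/
theorem exists_uniform_lower_bound {Ω : Type*} [MeasurableSpace Ω] {P : Measure Ω}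
    [IsProbabilityMeasure P] {ω : ℤ → Ω → ℝ} {μ : Measure ℝ} {Δ lam β Θ₁ : ℝ}
    (hH : IsRandomChain P ω μ Δ lam β) (hΘ : 2 * Θ₀ Δ < Θ₁) :
    ∃ (c : ℝ≥0∞) (l : ℕ), 0 < c ∧ ∀ n : ℕ, l + 1 ≤ n → c ≤
      ∫⁻ x, (⨆ g ∈ G (Set.Icc (Θ₀ Δ) Θ₁), ENNReal.ofReal (traceNorm
        (numOp (box (n + l + 1)) (-(n : ℤ))
          * funCalc (isHermitian_hamiltonian Δ lam β (fun k => ω k x) (n + l + 1)) g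
          * numOp (box (n + l + 1)) n))) ∂P := by
  have hΔ := hH.one_lt_Δ
  have hΘ₀ : 0 < Θ₀ Δ := by
    rw [Θ₀, sub_pos, div_lt_one (by linarith)]; exact hΔ
  have hd : 0 < min (Θ₀ Δ) (Θ₁ - 2 * Θ₀ Δ) := lt_min hΘ₀ (by linarith)
  have hI : ∀ E ∉ Set.Icc (Θ₀ Δ) Θ₁, min (Θ₀ Δ) (Θ₁ - 2 * Θ₀ Δ) ≤ |E - 2 * Θ₀ Δ| := by
    intro E hE
    rw [Set.mem_Icc, not_and_or, not_le, not_le] at hE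
    rcases hE with hE | hE
    · exact (min_le_left _ _).trans (by rw [abs_sub_comm]; exact (le_abs_self _).trans' (by linarith))
    · exact (min_le_right _ _).trans ((le_abs_self _).trans' (by linarith))
  obtain ⟨l, ε, hl, hε, hsmall⟩ := exists_tent_parameters lam hd
  have hq : 0 < μ (Metric.ball 0 ε) :=
    (Measure.mem_support_iff_forall _).1 (hH.subset_support (by simp)) _ (Metric.ball_mem_nhds _ hε)
  set c : ℝ≥0∞ := ENNReal.ofReal (1 / (4 * (2 * l + 1) ^ 2 : ℝ)) with hc
  refine ⟨c * μ (Metric.ball 0 ε) ^ (2 * (2 * l + 1)), l,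
    ENNReal.mul_pos (ENNReal.ofReal_pos.2 (by positivity)).ne' (pow_ne_zero _ hq.ne'), ?_⟩
  -- The condition `l + 1 ≤ n` separates the windows around `±n` as required, and the box `n + l +
  -- 1` keeps both off its boundary.
  intro n hn
  set T := Finset.Icc (-(n : ℤ) - l) (-n + l) ∪ Finset.Icc ((n : ℤ) - l) (n + l) with hT
  have hTcard : T.card ≤ 2 * (2 * l + 1) := by
    refine (Finset.card_union_le _ _).trans ?_
    rw [Int.card_Icc, Int.card_Icc]; omega
  set A := {x | ∀ k ∈ T, |ω k x| < ε} with hA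
  have hAmeas : MeasurableSet A := by
    have : A = ⋂ k ∈ T, {x | |ω k x| < ε} := by ext x; simp [hA]
    rw [this]
    exact T.measurableSet_biInter fun k _ =>
      measurableSet_lt (continuous_abs.measurable.comp (hH.measurable_ω k)) measurable_const
  calc c * μ (Metric.ball 0 ε) ^ (2 * (2 * l + 1)) ≤ c * P A := by
        gcongr
        exact pow_le_measure_forall_abs_lt hH.measurable_ω hH.law_ω hH.indep_ω ε hTcard
    _ = ∫⁻ x, A.indicator (fun _ => c) x ∂P := (lintegral_indicator_const hAmeas c).symm
    _ ≤ _ := by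
        refine lintegral_mono fun x => ?_
        by_cases hx : x ∈ A
        swap
        · rw [Set.indicator_of_notMem hx]; exact zero_le
        rw [Set.indicator_of_mem hx]
        refine le_iSup₂_of_le _ (indicator_one_mem_G measurableSet_Icc)
          (ENNReal.ofReal_le_ofReal ?_)
        refine le_traceNorm_of_small_field (ε := ε) hΔ hd hI hl (by push_cast; omega) (by omega)
          (by push_cast; omega) ?_ ?_ hsmall
        · intro a ha
          rw [Finset.mem_Icc] at ha
          exact (hx _ (by simp only [hT, Finset.mem_union, Finset.mem_Icc]; omega)).le
        · intro a ha
          rw [Finset.mem_Icc] at ha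
          exact (hx _ (by simp only [hT, Finset.mem_union, Finset.mem_Icc]; omega)).le

end XXZ

end

/-! ### Contradiction with exponential decay -/

theorem theorem2p1 {Ω : Type*} [MeasurableSpace Ω] (P : Measure Ω) [IsProbabilityMeasure P]
    (ω : ℤ → Ω → ℝ) (μ : Measure ℝ) (Δ lam β Θ₁ : ℝ)
    (hH : XXZ.IsRandomChain P ω μ Δ lam β)
    (hDL : XXZ.PropertyDL P ω Δ lam β Θ₁) :
    Θ₁ ≤ 2 * XXZ.Θ₀ Δ ∧
      ∃ δ : ℝ, 0 ≤ δ ∧ δ < 1 ∧ Set.Icc (XXZ.Θ₀ Δ) Θ₁ = XXZ.dropletInterval Δ δ := by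
  obtain ⟨hlt, C, m, hm, hbound⟩ := hDL
  have hΔ := hH.one_lt_Δ
  have hΘ₀ : 0 < XXZ.Θ₀ Δ := by
    rw [XXZ.Θ₀, sub_pos, div_lt_one (by linarith)]; exact hΔ
  have hle : Θ₁ ≤ 2 * XXZ.Θ₀ Δ := by
    by_contra hcon
    obtain ⟨c, l, hc, hlow⟩ := XXZ.exists_uniform_lower_bound hH (not_le.1 hcon)
    have hup : ∀ n : ℕ, l + 1 ≤ n → c ≤ ENNReal.ofReal (C * Real.exp (-m * (2 * n))) := by
      intro n hn
      refine (hlow n hn).trans ((hbound (n + l + 1) (by omega) (-(n : ℤ))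
        (Finset.mem_Icc.2 (by push_cast; omega)) n (Finset.mem_Icc.2 (by push_cast; omega))).trans
        (le_of_eq ?_))
      have : |(((-(n : ℤ) : ℤ) : ℝ) - ((n : ℤ) : ℝ))| = 2 * n := by
        push_cast
        rw [abs_of_nonpos (by have : (0 : ℝ) ≤ n := n.cast_nonneg
                              linarith)]
        ring
      rw [this]
    have hlim : Filter.Tendsto (fun n : ℕ => ENNReal.ofReal (C * Real.exp (-m * (2 * n))))
        Filter.atTop (nhds 0) := by
      rw [← ENNReal.ofReal_zero, ← mul_zero C]
      refine ENNReal.tendsto_ofReal (Filter.Tendsto.const_mul C (Real.tendsto_exp_atBot.comp ?_))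
      exact (tendsto_natCast_atTop_atTop.const_mul_atTop two_pos).const_mul_atTop_of_neg (by linarith)
    exact hc.not_ge (ge_of_tendsto hlim (Filter.eventually_atTop.2 ⟨l + 1, hup⟩))
  -- `δ` solves `(2 - δ) Θ₀ = Θ₁`; then `δ < 1` is `Θ₀ < Θ₁`.
  refine ⟨hle, 2 - Θ₁ / XXZ.Θ₀ Δ, ?_, ?_, ?_⟩
  · rw [sub_nonneg, div_le_iff₀ hΘ₀]; exact hle
  · have : 1 < Θ₁ / XXZ.Θ₀ Δ := by rwa [one_lt_div hΘ₀]
    linarith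
  · rw [XXZ.dropletInterval, sub_sub_cancel, ← XXZ.Θ₀, div_mul_cancel₀ _ hΘ₀.ne']
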